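/- Let $d\ge 3$ be an odd integer, $X=\{1,\dots,d\}$, and let $T$ be the $d$-regular rooted tree whose vertices are the finite words over $X$, with root the empty word and with $u$ joined to $ux$ for every word $u$ and $x\in X$. Let $\mathrm{Aut}(T)$ be the group of graph automorphisms of $T$ fixing the root. For $g\in\mathrm{Aut}(T)$ and a vertex $u$, the section $g|_u\in\mathrm{Aut}(T)$ is defined by $g(uv)=g(u)\,g|_u(v)$ for all $v$. Let $G_d\le\mathrm{Aut}(T)$ be the group generated by $A=\{a_1,\dots,a_d\}$, where (with $a_{d+1}=a_1$, and $d+1$ read as $1$) $a_i$ acts on the first level as the transposition $(i\ \,i{+}1)$ and has sections $a_i|_i=a_i$, $a_i|_{i+1}=a_{i+1}$, and $a_i|_x=e$ for every other $x\in X$. For $G\le\mathrm{Aut}(T)$ let $\mathrm{St}_G(\widehat 1)$ be the subgroup of the elements of $G$ fixing every vertex of level $1$, and for a vertex $v$ let $\mathrm{Rist}_G(v)$ be the subgroup of the elements of $G$ fixing every vertex that does not have $v$ as a prefix. If $G$ is transitive on every level of $T$, then $G$ is called regular branch over a subgroup $K\le G$ if $K$ is nontrivial, has finite index in $G$, and for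 all $(k_1,\dots,k_d)\in K^d$ there is $g\in K\cap\mathrm{St}_G(\widehat 1)$ with $g|_x=k_x$ for all $x\in X$. Then $G_d$ is transitive on every level of $T$, and there is no subgroup $K\le G_d$ such that $G_d$ is regular branch over $K$. Moreover, for a word $w$ in the letters $a_i^{\pm1}$ let $|w|_A\in\mathbb Z$ be the total exponent sum of $w$. Then any two words representing the same element of $G_d$ have the same total exponent sum, so that for $k\ge 1$ one has the subgroup $$H_k=\{g\in G_d : |g|_A\equiv 0 \pmod{2^{k+1}}\}.$$ For every $k\ge1$ and every vertex $v$ of level $k$, with $\pi_v(g)=g|_v$, one has $\pi_v(\mathrm{Rist}_{G_d}(v))=H_k$; and $H_j\ne H_k$ whenever $j,k\ge 1$ and $j\neq k$. -/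

import Mathlib

namespace RootedTree

variable {d : ℕ}

/-- The `d`-regular rooted tree: its vertices are the finite words over `Fin d` (the letters
`1, …, d` are written `0, …, d - 1`), its root is the empty word, and every word `u` is joined
to its children `u ++ [x]`. -/
def tree (d : ℕ) : SimpleGraph (List (Fin d)) where
  Adj u v := (∃ x, v = u ++ [x]) ∨ (∃ x, u = v ++ [x])
  symm := ⟨fun _ _ h => h.symm⟩
  loopless := ⟨fun u h => by
    rcases h with ⟨x, hx⟩ | ⟨x, hx⟩ <;> simpa using congrArg List.length hx⟩

/-- `Aut(T)`: the graph automorphisms of the tree that fix the root, under composition. -/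
def treeAut (d : ℕ) : Subgroup (tree d ≃g tree d) where
  carrier := {g | g [] = []}
  mul_mem' {g h} hg hh := by
    change g (h []) = []
    rw [show h [] = [] from hh]
    exact hg
  one_mem' := rfl
  inv_mem' {g} hg := by
    change g.symm [] = []
    rw [RelIso.symm_apply_eq]
    exact hg.symm

/-- The action of a tree automorphism on vertices. -/
instance : CoeFun (treeAut d) (fun _ => List (Fin d) → List (Fin d)) := ⟨fun g => g.1⟩

theorem mul_apply (g h : treeAut d) (u : List (Fin d)) : (g * h) u = g (h u) := rfl

theorem inv_apply_self (g : treeAut d) (u : List (Fin d)) : g⁻¹ (g u) = u :=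
  g.1.symm_apply_apply u

theorem apply_inv_self (g : treeAut d) (u : List (Fin d)) : g (g⁻¹ u) = u :=
  g.1.apply_symm_apply u

theorem apply_nil (g : treeAut d) : g [] = [] := g.2

theorem apply_injective (g : treeAut d) : Function.Injective g := g.1.injective

theorem adj_iff (g : treeAut d) (u v : List (Fin d)) :
    (tree d).Adj (g u) (g v) ↔ (tree d).Adj u v := g.1.map_rel_iff

theorem ext' {g h : treeAut d} (H : ∀ u, g u = h u) : g = h :=
  Subtype.ext (RelIso.ext H)

/-- A root-fixing automorphism maps children to children. -/
theorem exists_apply_concat (g : treeAut d) (u : List (Fin d)) :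
    ∀ x, ∃ y, g (u ++ [x]) = g u ++ [y] := by
  induction u using List.reverseRecOn with
  | nil =>
    intro x
    have h := (adj_iff g [] ([] ++ [x])).2 (Or.inl ⟨x, rfl⟩)
    rcases h with h | ⟨y, h⟩
    · exact h
    · rw [apply_nil] at h
      simp at h
  | append_singleton u z ih =>
    intro x
    have h := (adj_iff g (u ++ [z]) (u ++ [z] ++ [x])).2 (Or.inl ⟨x, rfl⟩)
    rcases h with h | ⟨y, h⟩
    · exact h
    · obtain ⟨y', hy'⟩ := ih z
      rw [hy'] at h
      have h2 := apply_injective g (List.append_inj_left' h rfl)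
      simpa using congrArg List.length h2

theorem exists_apply_append (g : treeAut d) (u v : List (Fin d)) :
    ∃ v', g (u ++ v) = g u ++ v' := by
  induction v using List.reverseRecOn with
  | nil => exact ⟨[], by simp⟩
  | append_singleton v x ih =>
    obtain ⟨v', hv'⟩ := ih
    obtain ⟨y, hy⟩ := exists_apply_concat g (u ++ v) x
    exact ⟨v' ++ [y], by rw [← List.append_assoc, hy, hv', List.append_assoc]⟩

theorem length_apply (g : treeAut d) (u : List (Fin d)) : (g u).length = u.length := by
  induction u using List.reverseRecOn with
  | nil => rw [apply_nil]
  | append_singleton u x ih =>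
    obtain ⟨y, hy⟩ := exists_apply_concat g u x
    rw [hy]
    simp [ih]

/-- The word `v'` with `g (u ++ v) = g u ++ v'`. -/
def sectionFun (g : treeAut d) (u v : List (Fin d)) : List (Fin d) :=
  (g (u ++ v)).drop u.length

theorem apply_append (g : treeAut d) (u v : List (Fin d)) :
    g (u ++ v) = g u ++ sectionFun g u v := by
  obtain ⟨v', hv'⟩ := exists_apply_append g u v
  rw [sectionFun, hv', ← length_apply g u, List.drop_left]

theorem sectionFun_inv (g : treeAut d) (u v : List (Fin d)) :
    sectionFun g⁻¹ (g u) (sectionFun g u v) = v := by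
  have h := apply_append g⁻¹ (g u) (sectionFun g u v)
  rw [← apply_append, inv_apply_self, inv_apply_self] at h
  exact (List.append_cancel_left h).symm

theorem adj_append_iff (u v w : List (Fin d)) :
    (tree d).Adj (u ++ v) (u ++ w) ↔ (tree d).Adj v w := by
  simp [tree, List.append_assoc]

/-- The section `g|_u`: the automorphism `v ↦ v'` with `g (u ++ v) = g u ++ v'`
(see `apply_append`). -/
def sectionAt (g : treeAut d) (u : List (Fin d)) : treeAut d :=
  ⟨{ toFun := sectionFun g u
     invFun := sectionFun g⁻¹ (g u)
     left_inv := sectionFun_inv g u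
     right_inv := fun v => by
       have h := sectionFun_inv g⁻¹ (g u) v
       rwa [inv_inv, inv_apply_self] at h
     map_rel_iff' := fun {v w} => by
       change (tree d).Adj (sectionFun g u v) (sectionFun g u w) ↔ _
       rw [← adj_append_iff (g u), ← apply_append, ← apply_append, adj_iff, adj_append_iff] },
   by
     change sectionFun g u [] = []
     rw [sectionFun, List.append_nil, ← length_apply g u, List.drop_length]⟩

theorem sectionAt_spec (g : treeAut d) (u v : List (Fin d)) :
    g (u ++ v) = g u ++ sectionAt g u v := apply_append g u v

/-- `G` acts transitively on every level of the tree. -/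
def IsLevelTransitive (G : Subgroup (treeAut d)) : Prop :=
  ∀ u v : List (Fin d), u.length = v.length → ∃ g ∈ G, g u = v

/-- The `k`-th level stabilizer of `G`. -/
def levelStabilizer (G : Subgroup (treeAut d)) (k : ℕ) : Subgroup (treeAut d) where
  carrier := {g | g ∈ G ∧ ∀ u : List (Fin d), u.length = k → g u = u}
  mul_mem' {g h} hg hh := ⟨G.mul_mem hg.1 hh.1, fun u hu => by
    rw [mul_apply, hh.2 u hu, hg.2 u hu]⟩
  one_mem' := ⟨G.one_mem, fun _ _ => rfl⟩
  inv_mem' {g} hg := ⟨G.inv_mem hg.1, fun u hu => by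
    conv_lhs => rw [← hg.2 u hu]
    exact inv_apply_self g u⟩

/-- The rigid stabilizer of the vertex `u` in `G`: the elements of `G` that fix every vertex
outside the subtree of the words with prefix `u`. -/
def rigidStabilizer (G : Subgroup (treeAut d)) (u : List (Fin d)) : Subgroup (treeAut d) where
  carrier := {g | g ∈ G ∧ ∀ w : List (Fin d), ¬ u <+: w → g w = w}
  mul_mem' {g h} hg hh := ⟨G.mul_mem hg.1 hh.1, fun u hu => by
    rw [mul_apply, hh.2 u hu, hg.2 u hu]⟩
  one_mem' := ⟨G.one_mem, fun _ _ => rfl⟩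
  inv_mem' {g} hg := ⟨G.inv_mem hg.1, fun u hu => by
    conv_lhs => rw [← hg.2 u hu]
    exact inv_apply_self g u⟩

/-- `G` is weakly regular branch over its subgroup `K`: `G` is transitive on every level, `K` is
nontrivial, and `K × ⋯ × K ≤ ψ(K ∩ St_G(1))`, where `ψ` sends an element of the first level
stabilizer to the tuple of its sections at the vertices of level one. -/
structure IsWeaklyRegularBranchOver (G K : Subgroup (treeAut d)) : Prop where
  levelTransitive : IsLevelTransitive G
  le : K ≤ G
  nontrivial : K ≠ ⊥
  prod_le : ∀ f : Fin d → treeAut d, (∀ x, f x ∈ K) →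
    ∃ g ∈ K ⊓ levelStabilizer G 1, ∀ x, sectionAt g [x] = f x

/-- `G` is regular branch over its subgroup `K`: it is weakly regular branch over `K`, and `K`
has finite index in `G`. -/
structure IsRegularBranchOver (G K : Subgroup (treeAut d)) : Prop
    extends IsWeaklyRegularBranchOver G K where
  finiteIndex : (K.subgroupOf G).FiniteIndex

/-- The action of `a_i` on words. Here `finRotate d i` is the cyclic successor of `i`; the
automorphism `a_i` exchanges the letters `i` and `finRotate d i` at the first level, has section
`a_i` at `i`, section `a_{finRotate d i}` at `finRotate d i`, and trivial section at every other
letter. -/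
def genFun : Fin d → List (Fin d) → List (Fin d)
  | _, [] => []
  | i, x :: v => Equiv.swap i (finRotate d i) x ::
      (if x = i then genFun i v
        else if x = finRotate d i then genFun (finRotate d i) v else v)

/-- The inverse of `genFun`. -/
def genInvFun : Fin d → List (Fin d) → List (Fin d)
  | _, [] => []
  | i, y :: v => Equiv.swap i (finRotate d i) y ::
      (if Equiv.swap i (finRotate d i) y = i then genInvFun i v
        else if Equiv.swap i (finRotate d i) y = finRotate d i then
          genInvFun (finRotate d i) v else v)

theorem genInvFun_genFun (i : Fin d) (v : List (Fin d)) : genInvFun i (genFun i v) = v := by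
  induction v generalizing i with
  | nil => rfl
  | cons x v ih =>
    simp only [genFun, genInvFun, Equiv.swap_apply_self]
    split_ifs <;> simp [ih]

theorem genFun_genInvFun (i : Fin d) (v : List (Fin d)) : genFun i (genInvFun i v) = v := by
  induction v generalizing i with
  | nil => rfl
  | cons x v ih =>
    simp only [genFun, genInvFun, Equiv.swap_apply_self]
    split_ifs <;> simp [ih]

theorem genFun_concat (i : Fin d) (v : List (Fin d)) (x : Fin d) :
    ∃ y, genFun i (v ++ [x]) = genFun i v ++ [y] := by
  induction v generalizing i with
  | nil => exact ⟨Equiv.swap i (finRotate d i) x, by simp [genFun]⟩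
  | cons z v ih =>
    simp only [List.cons_append, genFun]
    split_ifs
    · simpa using ih i
    · simpa using ih (finRotate d i)
    · simp

theorem genInvFun_concat (i : Fin d) (v : List (Fin d)) (x : Fin d) :
    ∃ y, genInvFun i (v ++ [x]) = genInvFun i v ++ [y] := by
  induction v generalizing i with
  | nil => exact ⟨Equiv.swap i (finRotate d i) x, by simp [genInvFun]⟩
  | cons z v ih =>
    simp only [List.cons_append, genInvFun]
    split_ifs
    · simpa using ih i
    · simpa using ih (finRotate d i)
    · simp

theorem adj_of_concat (f : List (Fin d) → List (Fin d))
    (hf : ∀ v x, ∃ y, f (v ++ [x]) = f v ++ [y]) {u v : List (Fin d)}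
    (h : (tree d).Adj u v) : (tree d).Adj (f u) (f v) := by
  rcases h with ⟨x, rfl⟩ | ⟨x, rfl⟩
  · exact Or.inl (hf u x)
  · exact Or.inr (hf v x)

/-- The automorphism `a_i`. -/
def gen (i : Fin d) : treeAut d :=
  ⟨{ toFun := genFun i
     invFun := genInvFun i
     left_inv := genInvFun_genFun i
     right_inv := genFun_genInvFun i
     map_rel_iff' := fun {u v} => by
       change (tree d).Adj (genFun i u) (genFun i v) ↔ _
       refine ⟨fun h => ?_, adj_of_concat _ (genFun_concat i)⟩
       have h2 := adj_of_concat _ (genInvFun_concat i) h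
       rwa [genInvFun_genFun, genInvFun_genFun] at h2 }, rfl⟩

/-- The action of `a_i` on the first level. -/
theorem gen_apply_singleton (i x : Fin d) :
    gen i [x] = [Equiv.swap i (finRotate d i) x] := by
  change genFun i [x] = _
  simp [genFun]

/-- The sections of `a_i` at the first level. -/
theorem sectionAt_gen (i x : Fin d) :
    sectionAt (gen i) [x] = if x = i then gen i
      else if x = finRotate d i then gen (finRotate d i) else 1 := by
  apply ext'
  intro v
  change (genFun i ([x] ++ v)).drop 1 = _
  simp only [List.singleton_append, genFun, List.drop_succ_cons, List.drop_zero]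
  split_ifs <;> rfl

/-- The group `G_d`, generated by `a_1, …, a_d`. -/
def groupG (d : ℕ) : Subgroup (treeAut d) := Subgroup.closure (Set.range gen)

/-- The automorphism represented by a word in the letters `a_i` and their inverses. -/
def evalWord : FreeGroup (Fin d) →* treeAut d := FreeGroup.lift gen

/-- The total exponent sum `|w|_A` of a word `w` in the letters `a_i` and their inverses. -/
def expSum (w : FreeGroup (Fin d)) : ℤ :=
  (FreeGroup.lift (fun _ : Fin d => Multiplicative.ofAdd (1 : ℤ)) w).toAdd

/-- `H_k`: the elements of `G_d` represented by a word with total exponent sum divisible by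
`2 ^ (k + 1)`. -/
def groupH (d k : ℕ) : Subgroup (treeAut d) where
  carrier := {g | ∃ w : FreeGroup (Fin d), evalWord w = g ∧ (2 : ℤ) ^ (k + 1) ∣ expSum w}
  mul_mem' := by
    rintro _ _ ⟨w, rfl, hw⟩ ⟨w', rfl, hw'⟩
    refine ⟨w * w', map_mul _ _ _, ?_⟩
    simpa [expSum] using dvd_add hw hw'
  one_mem' := ⟨1, map_one _, by simp [expSum]⟩
  inv_mem' := by
    rintro _ ⟨w, rfl, hw⟩
    exact ⟨w⁻¹, map_inv _ _, by simpa [expSum] using hw⟩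

end RootedTree

namespace RootedTree

variable {d : ℕ}

/-! A letter `a_i^{±1}` moves exactly two points of the alphabet and leaves a letter of the same
sign at each of them, so passing to the first level doubles the total exponent sum. Everything rests
on this doubling.

The exponent sum is well defined (`not_isMinRelator`): among the shortest relators of non-zero
exponent sum, one with the largest absolute value would have exactly two sections of non-zero sum,
both again extremal. Being full at two points forces such a word to begin with a repeated letter,
but then its section at a point where it is full begins with two different indices.

No branching subgroup exists: finite index gives `K` an element of positive exponent sum, and a
preimage of `(k, 1, …, 1)` in `K` halves that sum, an infinite descent.

For the rigid stabilizers, an element that is trivial outside one vertex of level `k` has section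
sum `2^k n`. Here `n` is even, because the element fixes the first level and the sign of the action
there is the parity of `n`. Conversely, self-replication (`reach_of_mem`, where `d` odd enters)
makes the sections of rigid stabilizers of letters closed under conjugation by `G_d`. A braid
comparison identifies all generators modulo them, and an explicit product supplies exponent sum
four, so they include every element of sum divisible by four. Deeper levels follow by induction. -/

/-! ### Sections and the action on the first level -/

theorem sectionAt_mul (g h : treeAut d) (u : List (Fin d)) :
    sectionAt (g * h) u = sectionAt g (h u) * sectionAt h u := by
  apply ext'
  intro v
  have h1 := sectionAt_spec (g * h) u v
  rw [mul_apply, sectionAt_spec h, sectionAt_spec g, mul_apply] at h1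
  exact (List.append_cancel_left h1).symm

theorem sectionAt_one (u : List (Fin d)) : sectionAt (1 : treeAut d) u = 1 := by
  apply ext'
  intro v
  exact (List.append_cancel_left (sectionAt_spec (1 : treeAut d) u v)).symm

theorem sectionAt_append (g : treeAut d) (u v : List (Fin d)) :
    sectionAt g (u ++ v) = sectionAt (sectionAt g u) v := by
  apply ext'
  intro w
  have h1 := sectionAt_spec g (u ++ v) w
  rw [List.append_assoc, sectionAt_spec g u, sectionAt_spec g u, sectionAt_spec (sectionAt g u) v,
    List.append_assoc] at h1
  exact (List.append_cancel_left (List.append_cancel_left h1)).symm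

/-- The letter `y` with `g [x] = [y]`. -/
def rootFun (g : treeAut d) (x : Fin d) : Fin d :=
  (g [x]).head (List.ne_nil_of_length_eq_add_one (length_apply g [x]))

theorem apply_singleton_rootFun (g : treeAut d) (x : Fin d) : g [x] = [rootFun g x] := by
  obtain ⟨y, hy⟩ := List.length_eq_one_iff.1 (length_apply g [x])
  simp [rootFun, hy]

/-- The action of a tree automorphism on the letters, i.e. on the first level. -/
def rootPerm : treeAut d →* Equiv.Perm (Fin d) :=
  -- Multiplicativity is enough: the letter maps are invertible because the automorphisms are.
  MonoidHom.toHomPerm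
    { toFun := rootFun
      map_one' := by
        funext x
        exact (List.singleton_injective (apply_singleton_rootFun (1 : treeAut d) x)).symm
      map_mul' := fun g h => by
        funext x
        have h1 := apply_singleton_rootFun (g * h) x
        rw [mul_apply, apply_singleton_rootFun h, apply_singleton_rootFun g] at h1
        exact (List.singleton_injective h1).symm }

theorem apply_singleton (g : treeAut d) (x : Fin d) : g [x] = [rootPerm g x] :=
  apply_singleton_rootFun g x

theorem apply_cons (g : treeAut d) (x : Fin d) (u : List (Fin d)) :
    g (x :: u) = rootPerm g x :: sectionAt g [x] u := by
  have h := sectionAt_spec g [x] u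
  rwa [apply_singleton] at h

theorem sectionAt_mul_singleton (g h : treeAut d) (x : Fin d) :
    sectionAt (g * h) [x] = sectionAt g [rootPerm h x] * sectionAt h [x] := by
  rw [sectionAt_mul, apply_singleton]

theorem rootPerm_apply_inv (g : treeAut d) (x : Fin d) :
    rootPerm g ((rootPerm g)⁻¹ x) = x :=
  (rootPerm g).apply_symm_apply x

theorem sectionAt_inv_singleton (g : treeAut d) (x : Fin d) :
    sectionAt g⁻¹ [x] = (sectionAt g [(rootPerm g)⁻¹ x])⁻¹ := by
  rw [eq_inv_iff_mul_eq_one]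
  have h := sectionAt_mul_singleton g⁻¹ g ((rootPerm g)⁻¹ x)
  rw [inv_mul_cancel, sectionAt_one, rootPerm_apply_inv] at h
  exact h.symm

theorem rootPerm_gen (i : Fin d) : rootPerm (gen i) = Equiv.swap i (finRotate d i) := by
  ext1 x
  have h := gen_apply_singleton i x
  rw [apply_singleton] at h
  exact List.singleton_injective h

/-! ### Words and their sections -/

/-- The automorphism given by a letter `a_i` or its inverse. -/
def letterAut (l : Fin d × Bool) : treeAut d := cond l.2 (gen l.1) (gen l.1)⁻¹

/-- The exponent of a letter. -/
def letterExp (l : Fin d × Bool) : ℤ := cond l.2 1 (-1)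

/-- The transposition by which a letter acts on the first level. -/
def letterPerm (l : Fin d × Bool) : Equiv.Perm (Fin d) := Equiv.swap l.1 (finRotate d l.1)

/-- The automorphism represented by a list of letters. -/
def listAut (L : List (Fin d × Bool)) : treeAut d := (L.map letterAut).prod

/-- The total exponent sum of a list of letters. -/
def listExp (L : List (Fin d × Bool)) : ℤ := (L.map letterExp).sum

theorem evalWord_mk (L : List (Fin d × Bool)) : evalWord (FreeGroup.mk L) = listAut L := by
  simp only [evalWord, FreeGroup.lift_mk]
  rfl

theorem expSum_mk (L : List (Fin d × Bool)) : expSum (FreeGroup.mk L) = listExp L := by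
  simp only [expSum, FreeGroup.lift_mk]
  induction L with
  | nil => rfl
  | cons l L ih =>
    rcases l with ⟨i, b⟩
    cases b <;> simp_all [listExp, letterExp]

/-- The section of a letter at a letter of the alphabet, as a word of length at most one. -/
def letterSection (l : Fin d × Bool) (x : Fin d) : List (Fin d × Bool) :=
  if letterPerm l x = x then [] else [(cond l.2 x (letterPerm l x), l.2)]

/-- The section of a word at a letter of the alphabet, as a word. -/
def listSection : List (Fin d × Bool) → Fin d → List (Fin d × Bool)
  | [], _ => []
  | l :: L, x => letterSection l (rootPerm (listAut L) x) ++ listSection L x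

theorem rootPerm_letterAut (l : Fin d × Bool) : rootPerm (letterAut l) = letterPerm l := by
  rcases l with ⟨i, b⟩
  cases b <;> simp [letterAut, letterPerm, rootPerm_gen]

theorem listAut_cons (l : Fin d × Bool) (L : List (Fin d × Bool)) :
    listAut (l :: L) = letterAut l * listAut L := by
  simp [listAut]

theorem listAut_append (L L' : List (Fin d × Bool)) :
    listAut (L ++ L') = listAut L * listAut L' := by
  simp [listAut]

theorem listExp_cons (l : Fin d × Bool) (L : List (Fin d × Bool)) :
    listExp (l :: L) = letterExp l + listExp L := by
  simp [listExp]

theorem listExp_append (L L' : List (Fin d × Bool)) :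
    listExp (L ++ L') = listExp L + listExp L' := by
  simp [listExp]

theorem finRotate_ne (hd : 2 ≤ d) (x : Fin d) : finRotate d x ≠ x := by
  obtain ⟨n, rfl⟩ := Nat.exists_eq_add_of_le' hd
  have h := (support_finRotate (n := n)) ▸ Finset.mem_univ x
  exact Equiv.Perm.mem_support.1 h

theorem finRotate_finRotate_ne (hd : 3 ≤ d) (x : Fin d) : finRotate d (finRotate d x) ≠ x := by
  obtain ⟨n, rfl⟩ := Nat.exists_eq_add_of_le' hd
  rw [finRotate_apply, finRotate_apply, add_assoc, Ne, add_eq_left]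
  intro h
  have h2 := congrArg Fin.val h
  simp only [Fin.val_add, Fin.coe_ofNat_eq_mod, Nat.add_mod_mod, Nat.mod_add_mod] at h2
  rw [Nat.mod_eq_of_lt (by omega)] at h2
  simp at h2

theorem letterPerm_apply_ne_iff (hd : 2 ≤ d) (l : Fin d × Bool) (x : Fin d) :
    letterPerm l x ≠ x ↔ x = l.1 ∨ x = finRotate d l.1 := by
  rw [letterPerm, Equiv.swap_apply_ne_self_iff]
  simp [(finRotate_ne hd l.1).symm, -finRotate_apply]

theorem listAut_letterSection (hd : 2 ≤ d) (l : Fin d × Bool) (x : Fin d) :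
    listAut (letterSection l x) = sectionAt (letterAut l) [x] := by
  have hne := finRotate_ne hd
  rcases l with ⟨i, b⟩
  by_cases h : letterPerm (i, b) x = x
  · have h' := mt (letterPerm_apply_ne_iff hd (i, b) x).2 (not_not.2 h)
    simp only [not_or] at h'
    cases b
    · rw [letterSection, if_pos h]
      simp only [letterPerm] at h
      simp [listAut, letterAut, sectionAt_inv_singleton, rootPerm_gen, h,
        sectionAt_gen, h', -finRotate_apply]
    · simp [letterSection, h, listAut, letterAut, sectionAt_gen, h', -finRotate_apply]
  · have h' := (letterPerm_apply_ne_iff hd (i, b) x).1 h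
    rw [letterSection, if_neg h]
    cases b <;> rcases h' with h' | h' <;> simp only at h' <;> subst h' <;>
      simp [listAut, letterAut, sectionAt_inv_singleton, rootPerm_gen, sectionAt_gen, hne,
        letterPerm, -finRotate_apply]

theorem listAut_listSection (hd : 2 ≤ d) (L : List (Fin d × Bool)) (x : Fin d) :
    listAut (listSection L x) = sectionAt (listAut L) [x] := by
  induction L with
  | nil => exact (sectionAt_one [x]).symm
  | cons l L ih =>
    rw [listSection, listAut_append, listAut_cons, sectionAt_mul_singleton, ih,
      listAut_letterSection hd]

theorem sum_listExp_letterSection (hd : 2 ≤ d) (l : Fin d × Bool) :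
    ∑ x, listExp (letterSection l x) = 2 * letterExp l := by
  have h : ∀ x, listExp (letterSection l x) =
      if x ∈ ({l.1, finRotate d l.1} : Finset (Fin d)) then letterExp l else 0 := by
    intro x
    have h' := letterPerm_apply_ne_iff hd l x
    by_cases hx : letterPerm l x = x
    · rw [letterSection, if_pos hx, if_neg]
      · rfl
      · simpa [hx] using h'
    · rw [letterSection, if_neg hx, if_pos]
      · simp [listExp, letterExp]
      · simpa [hx] using h'
  simp only [h]
  rw [Finset.sum_ite_mem, Finset.univ_inter, Finset.sum_const,
    Finset.card_pair (finRotate_ne hd l.1).symm]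
  simp

/-- The tail of the word permutes the points at which the sections of the leading letter are taken,
so the sum for that letter is unchanged. -/
theorem sum_listExp_listSection (hd : 2 ≤ d) (L : List (Fin d × Bool)) :
    ∑ x, listExp (listSection L x) = 2 * listExp L := by
  induction L with
  | nil => simp [listSection, listExp]
  | cons l L ih =>
    simp only [listSection, listExp_append, Finset.sum_add_distrib, ih, listExp_cons]
    rw [Equiv.sum_comp (rootPerm (listAut L)) (fun x => listExp (letterSection l x)),
      sum_listExp_letterSection hd]
    ring

theorem length_letterSection_le (l : Fin d × Bool) (x : Fin d) :
    (letterSection l x).length ≤ 1 := by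
  rw [letterSection]
  split_ifs <;> simp

theorem length_listSection_le (L : List (Fin d × Bool)) (x : Fin d) :
    (listSection L x).length ≤ L.length := by
  induction L with
  | nil => simp [listSection]
  | cons l L ih =>
    have := length_letterSection_le l (rootPerm (listAut L) x)
    simp only [listSection, List.length_append, List.length_cons]
    omega

theorem natAbs_listExp_le (L : List (Fin d × Bool)) : (listExp L).natAbs ≤ L.length := by
  induction L with
  | nil => simp [listExp]
  | cons l L ih =>
    have h : (letterExp l).natAbs = 1 := by
      rcases l with ⟨i, b⟩
      cases b <;> rfl
    rw [listExp_cons, List.length_cons]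
    omega

/-- Every letter acts as a transposition, whatever its sign. -/
theorem sign_rootPerm_listAut (hd : 2 ≤ d) (L : List (Fin d × Bool)) :
    Equiv.Perm.sign (rootPerm (listAut L)) = (-1) ^ (listExp L) := by
  induction L with
  | nil => simp [listAut, listExp]
  | cons l L ih =>
    rw [listAut_cons, map_mul, map_mul, ih, listExp_cons, zpow_add, rootPerm_letterAut,
      letterPerm, Equiv.Perm.sign_swap (finRotate_ne hd l.1).symm]
    rcases l with ⟨i, b⟩
    cases b <;> simp [letterExp]

theorem even_listExp (hd : 2 ≤ d) {L : List (Fin d × Bool)} (h : rootPerm (listAut L) = 1) :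
    Even (listExp L) := by
  have h1 := sign_rootPerm_listAut hd L
  rw [h, map_one] at h1
  by_contra h2
  rw [Int.not_even_iff_odd] at h2
  rw [h2.neg_one_zpow] at h1
  exact absurd h1 (by decide)

/-! ### The total exponent sum is well defined -/

/-- A word `L` has full section at `x` if each of its letters moves the orbit of `x`. -/
def IsFullAt (L : List (Fin d × Bool)) (x : Fin d) : Prop :=
  (listSection L x).length = L.length

theorem IsFullAt.of_cons {l : Fin d × Bool} {L : List (Fin d × Bool)} {x : Fin d}
    (h : IsFullAt (l :: L) x) :
    letterPerm l (rootPerm (listAut L) x) ≠ rootPerm (listAut L) x ∧ IsFullAt L x := by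
  have h1 := length_letterSection_le l (rootPerm (listAut L) x)
  have h2 := length_listSection_le L x
  simp only [IsFullAt, listSection, List.length_append, List.length_cons] at h
  refine ⟨fun h3 => ?_, by rw [IsFullAt]; omega⟩
  rw [letterSection, if_pos h3, List.length_nil] at h
  omega

/-- The first two letters of a word that is full at two letters have the same index. -/
theorem IsFullAt.index_eq (hd : 3 ≤ d) {l l' : Fin d × Bool} {L : List (Fin d × Bool)}
    {x y : Fin d} (hxy : x ≠ y) (hx : IsFullAt (l :: l' :: L) x)
    (hy : IsFullAt (l :: l' :: L) y) : l.1 = l'.1 := by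
  obtain ⟨hx1, hx'⟩ := hx.of_cons
  obtain ⟨hy1, hy'⟩ := hy.of_cons
  have hx2 := hx'.of_cons.1
  have hy2 := hy'.of_cons.1
  have hpq : rootPerm (listAut L) x ≠ rootPerm (listAut L) y :=
    (rootPerm (listAut L)).injective.ne hxy
  rw [listAut_cons, map_mul, Equiv.Perm.mul_apply, rootPerm_letterAut,
    letterPerm_apply_ne_iff (by omega)] at hx1 hy1
  rw [letterPerm_apply_ne_iff (by omega)] at hx2 hy2
  have h2 := finRotate_finRotate_ne hd l'.1
  generalize rootPerm (listAut L) x = p at *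
  generalize rootPerm (listAut L) y = q at *
  have h3 : letterPerm l' l'.1 = finRotate d l'.1 := Equiv.swap_apply_left _ _
  have h4 : letterPerm l' (finRotate d l'.1) = l'.1 := Equiv.swap_apply_right _ _
  -- `l'` moves `p` and `q`, so they are its two points and it swaps them; `l` moves both as well.
  -- Two cyclically adjacent pairs that coincide have the same index, since `h2` rules out the
  -- reversed reading.
  rcases hx2 with rfl | rfl <;> rcases hy2 with rfl | rfl <;> grind

/-- A word is full at no more than two letters. -/
theorem IsFullAt.eq_or_eq (hd : 3 ≤ d) {L : List (Fin d × Bool)} (hL : L ≠ [])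
    {x y z : Fin d} (hxy : x ≠ y) (hx : IsFullAt L x)
    (hy : IsFullAt L y) (hz : IsFullAt L z) : z = x ∨ z = y := by
  obtain ⟨l, L, rfl⟩ := List.exists_cons_of_ne_nil hL
  have hx1 := hx.of_cons.1
  have hy1 := hy.of_cons.1
  have hz1 := hz.of_cons.1
  rw [letterPerm_apply_ne_iff (by omega)] at hx1 hy1 hz1
  -- The leading letter moves only two points, and the tail acts injectively.
  have h := (rootPerm (listAut L)).injective
  have := @h x y
  have := @h z x
  have := @h z y
  grind

/-- `L` is a relator with non-zero exponent sum, of the least possible length. -/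
structure IsMinRelator (L : List (Fin d × Bool)) : Prop where
  listAut_eq : listAut L = 1
  listExp_ne : listExp L ≠ 0
  min : ∀ L' : List (Fin d × Bool), listAut L' = 1 → listExp L' ≠ 0 → L.length ≤ L'.length

theorem IsMinRelator.exists_cons_cons (hd : 3 ≤ d) {L : List (Fin d × Bool)}
    (h : IsMinRelator L) : ∃ l l' L', L = l :: l' :: L' := by
  have h1 := even_listExp (L := L) (by omega) (by rw [h.listAut_eq, map_one])
  have h2 := natAbs_listExp_le L
  have h3 := h.listExp_ne
  match L with
  | [] => simp [listExp] at h3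
  | [l] =>
    obtain ⟨m, hm⟩ := h1
    simp only [List.length_singleton] at h2
    omega
  | l :: l' :: L' => exact ⟨l, l', L', rfl⟩

theorem IsMinRelator.letter_eq (hd : 3 ≤ d) {l l' : Fin d × Bool} {L : List (Fin d × Bool)}
    (h : IsMinRelator (l :: l' :: L)) {x y : Fin d} (hxy : x ≠ y)
    (hx : IsFullAt (l :: l' :: L) x) (hy : IsFullAt (l :: l' :: L) y) : l = l' := by
  have h1 := IsFullAt.index_eq hd hxy hx hy
  by_contra hne
  -- Equal indices with opposite signs cancel, leaving a shorter relator with the same exponent sum.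
  have h2 : letterAut l * letterAut l' = 1 ∧ letterExp l + letterExp l' = 0 := by
    rcases l with ⟨i, b⟩
    rcases l' with ⟨j, c⟩
    simp only at h1
    subst h1
    cases b <;> cases c <;> simp_all [letterAut, letterExp]
  have h3 := h.listAut_eq
  have h4 := h.listExp_ne
  rw [listAut_cons, listAut_cons, ← mul_assoc, h2.1, one_mul] at h3
  rw [listExp_cons, listExp_cons, ← add_assoc, h2.2, zero_add] at h4
  have h5 := h.min L h3 h4
  simp at h5

/-- If a word starts with a repeated letter and is full at `x`, then its section at `x` starts
with letters of different indices. -/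
theorem IsFullAt.exists_listSection {l : Fin d × Bool} {L : List (Fin d × Bool)} {x : Fin d}
    (h : IsFullAt (l :: l :: L) x) :
    ∃ k k' L', listSection (l :: l :: L) x = k :: k' :: L' ∧ k.1 ≠ k'.1 := by
  obtain ⟨h1, h'⟩ := h.of_cons
  have h2 := h'.of_cons.1
  rw [listSection, listSection, letterSection, if_neg h1, letterSection, if_neg h2]
  refine ⟨_, _, _, rfl, ?_⟩
  rw [listAut_cons, map_mul, Equiv.Perm.mul_apply, rootPerm_letterAut] at h1 ⊢
  -- The indices in the section record points on the path of `x`: the point before each step for a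
  -- generator, the point after it for an inverse. Fullness makes consecutive points differ.
  cases hl : l.2
  · simpa using h1
  · simpa using h2

/-- Sections of a relator are relators that are no longer, so in a minimal one every section of
non-zero sum is again minimal and has full length. Maximizing the absolute sum then makes the
extremal property pass to sections, and two successive levels contradict each other. -/
theorem not_isMinRelator (hd : 3 ≤ d) (L : List (Fin d × Bool)) : ¬ IsMinRelator L := by
  intro hL
  let S : Set (List (Fin d × Bool)) := {L' | IsMinRelator L'}
  -- Minimal relators share one length, over a finite alphabet.
  have hS : S.Finite := by
    refine (List.finite_length_eq (Fin d × Bool) L.length).subset fun L' hL' => ?_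
    exact le_antisymm (hL'.min L hL.listAut_eq hL.listExp_ne)
      (hL.min L' hL'.listAut_eq hL'.listExp_ne)
  obtain ⟨M, hM, hmax⟩ := Set.exists_max_image S (fun L => (listExp L).natAbs) hS ⟨L, hL⟩
  have hsec : ∀ N : List (Fin d × Bool), IsMinRelator N → ∀ x, listExp (listSection N x) ≠ 0 →
      IsMinRelator (listSection N x) ∧ IsFullAt N x := by
    intro N hN x hx
    have h1 : listAut (listSection N x) = 1 := by
      rw [listAut_listSection (by omega), hN.listAut_eq, sectionAt_one]
    have h2 : IsFullAt N x := le_antisymm (length_listSection_le N x) (hN.min _ h1 hx)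
    exact ⟨⟨h1, hx, fun L' h3 h4 => h2.le.trans (hN.min L' h3 h4)⟩, h2⟩
  have key : ∀ N : List (Fin d × Bool), IsMinRelator N →
      (listExp N).natAbs = (listExp M).natAbs →
      ∃ x y, x ≠ y ∧ IsFullAt N x ∧ IsFullAt N y ∧ IsMinRelator (listSection N x) ∧
        (listExp (listSection N x)).natAbs = (listExp M).natAbs := by
    intro N hN hNM
    have hsum := sum_listExp_listSection (by omega) N
    have hN0 := hN.listExp_ne
    have hle : ∀ x, (listExp (listSection N x)).natAbs ≤ (listExp M).natAbs := by
      intro x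
      by_cases hx : listExp (listSection N x) = 0
      · simp [hx]
      · exact hmax _ (hsec N hN x hx).1
    obtain ⟨x, -, hx⟩ : ∃ x ∈ Finset.univ, listExp (listSection N x) ≠ 0 := by
      apply Finset.exists_ne_zero_of_sum_ne_zero
      rw [hsum]
      simpa using hN0
    -- A single non-zero section would carry twice the maximal absolute sum.
    obtain ⟨y, hyx, hy⟩ : ∃ y, y ≠ x ∧ listExp (listSection N y) ≠ 0 := by
      by_contra! hcon
      rw [Finset.sum_eq_single x (fun y _ hy => hcon y hy) (by simp)] at hsum
      have := hle x
      omega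
    refine ⟨x, y, hyx.symm, (hsec N hN x hx).2, (hsec N hN y hy).2, (hsec N hN x hx).1, ?_⟩
    have hN1 : N ≠ [] := by
      rintro rfl
      exact hN0 rfl
    -- Only `x` and `y` contribute. Their two sums are bounded by the maximum and add up to twice it
    -- in absolute value, so each attains it.
    rw [← Finset.sum_subset (Finset.subset_univ {x, y}), Finset.sum_pair hyx.symm] at hsum
    · have := hle x
      have := hle y
      omega
    · intro z _ hz
      by_contra hz0
      apply hz
      simpa using IsFullAt.eq_or_eq hd hN1 hyx.symm (hsec N hN x hx).2 (hsec N hN y hy).2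
        (hsec N hN z hz0).2
  obtain ⟨x, y, hxy, hx, hy, hN, hNM⟩ := key M hM rfl
  obtain ⟨l, l', L', rfl⟩ := hM.exists_cons_cons hd
  obtain rfl := hM.letter_eq hd hxy hx hy
  obtain ⟨k, k', K, hK, hne⟩ := hx.exists_listSection
  obtain ⟨x', y', hxy', hx', hy', -⟩ := key _ hN hNM
  rw [hK] at hx' hy'
  exact hne (IsFullAt.index_eq hd hxy' hx' hy')

theorem listExp_eq_zero (hd : 3 ≤ d) {L : List (Fin d × Bool)} (h : listAut L = 1) :
    listExp L = 0 := by
  by_contra h0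
  obtain ⟨M, hM, hmin⟩ := (measure List.length).wf.has_min
    {L : List (Fin d × Bool) | listAut L = 1 ∧ listExp L ≠ 0} ⟨L, h, h0⟩
  exact not_isMinRelator hd M ⟨hM.1, hM.2, fun L' h1 h2 => not_lt.1 (hmin L' ⟨h1, h2⟩)⟩

theorem expSum_eq_of_evalWord_eq (hd : 3 ≤ d) {w w' : FreeGroup (Fin d)}
    (h : evalWord w = evalWord w') : expSum w = expSum w' := by
  obtain ⟨L, hL⟩ := Quot.exists_rep (w * w'⁻¹)
  have h1 : evalWord (w * w'⁻¹) = 1 := by rw [map_mul, map_inv, h, mul_inv_cancel]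
  have h2 : expSum (w * w'⁻¹) = expSum w - expSum w' := by simp [expSum, sub_eq_add_neg]
  change FreeGroup.mk L = _ at hL
  rw [← hL, evalWord_mk] at h1
  rw [← hL, expSum_mk, listExp_eq_zero hd h1] at h2
  omega

/-! ### Exponent sums of group elements -/

/-- `g` is represented by a word of total exponent sum `n`. -/
def HasExp (g : treeAut d) (n : ℤ) : Prop := ∃ w, evalWord w = g ∧ expSum w = n

theorem HasExp.unique (hd : 3 ≤ d) {g : treeAut d} {m n : ℤ} (h : HasExp g m)
    (h' : HasExp g n) : m = n := by
  obtain ⟨w, rfl, rfl⟩ := h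
  obtain ⟨w', hw, rfl⟩ := h'
  exact expSum_eq_of_evalWord_eq hd hw.symm

theorem HasExp.one : HasExp (1 : treeAut d) 0 := ⟨1, map_one _, by simp [expSum]⟩

theorem HasExp.mul {g h : treeAut d} {m n : ℤ} (hg : HasExp g m) (hh : HasExp h n) :
    HasExp (g * h) (m + n) := by
  obtain ⟨w, rfl, rfl⟩ := hg
  obtain ⟨w', rfl, rfl⟩ := hh
  exact ⟨w * w', map_mul _ _ _, by simp [expSum]⟩

theorem HasExp.inv {g : treeAut d} {m : ℤ} (hg : HasExp g m) : HasExp g⁻¹ (-m) := by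
  obtain ⟨w, rfl, rfl⟩ := hg
  exact ⟨w⁻¹, map_inv _ _, by simp [expSum]⟩

theorem HasExp.pow {g : treeAut d} {m : ℤ} (hg : HasExp g m) (n : ℕ) :
    HasExp (g ^ n) (n * m) := by
  obtain ⟨w, rfl, rfl⟩ := hg
  exact ⟨w ^ n, map_pow _ _ _, by simp [expSum]⟩

theorem HasExp.zpow {g : treeAut d} {m : ℤ} (hg : HasExp g m) (n : ℤ) :
    HasExp (g ^ n) (n * m) := by
  obtain ⟨w, rfl, rfl⟩ := hg
  exact ⟨w ^ n, map_zpow _ _ _, by simp [expSum]⟩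

theorem HasExp.gen (i : Fin d) : HasExp (gen i) 1 :=
  ⟨FreeGroup.of i, by simp [evalWord], by simp [expSum]⟩

theorem hasExp_iff_listAut {g : treeAut d} {n : ℤ} :
    HasExp g n ↔ ∃ L, listAut L = g ∧ listExp L = n := by
  constructor
  · rintro ⟨w, rfl, rfl⟩
    obtain ⟨L, rfl⟩ := Quot.exists_rep w
    exact ⟨L, (evalWord_mk L).symm, (expSum_mk L).symm⟩
  · rintro ⟨L, rfl, rfl⟩
    exact ⟨FreeGroup.mk L, evalWord_mk L, expSum_mk L⟩

theorem mem_groupG_iff {g : treeAut d} : g ∈ groupG d ↔ ∃ n, HasExp g n := by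
  rw [groupG, ← FreeGroup.range_lift_eq_closure]
  exact ⟨fun ⟨w, hw⟩ => ⟨_, w, hw, rfl⟩, fun ⟨_, w, hw, _⟩ => ⟨w, hw⟩⟩

theorem mem_groupH_iff {g : treeAut d} {k : ℕ} :
    g ∈ groupH d k ↔ ∃ n, HasExp g n ∧ (2 : ℤ) ^ (k + 1) ∣ n :=
  ⟨fun ⟨w, h1, h2⟩ => ⟨_, ⟨w, h1, rfl⟩, h2⟩, fun ⟨_, ⟨w, h1, h⟩, h2⟩ => ⟨w, h1, h ▸ h2⟩⟩

theorem gen_mem_groupG (i : Fin d) : gen i ∈ groupG d := mem_groupG_iff.2 ⟨1, HasExp.gen i⟩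

theorem HasExp.exists_sectionAt (hd : 3 ≤ d) {g : treeAut d} {n : ℤ} (h : HasExp g n) :
    ∃ m : Fin d → ℤ, (∀ x, HasExp (sectionAt g [x]) (m x)) ∧ ∑ x, m x = 2 * n := by
  obtain ⟨L, rfl, rfl⟩ := hasExp_iff_listAut.1 h
  exact ⟨fun x => listExp (listSection L x),
    fun x => hasExp_iff_listAut.2 ⟨_, listAut_listSection (by omega) L x, rfl⟩,
    sum_listExp_listSection (by omega) L⟩

theorem HasExp.even (hd : 3 ≤ d) {g : treeAut d} {n : ℤ} (h : HasExp g n)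
    (hg : rootPerm g = 1) : Even n := by
  obtain ⟨L, rfl, rfl⟩ := hasExp_iff_listAut.1 h
  exact even_listExp (by omega) hg

theorem sectionAt_mem_groupG (hd : 3 ≤ d) {g : treeAut d} (hg : g ∈ groupG d) (x : Fin d) :
    sectionAt g [x] ∈ groupG d := by
  obtain ⟨n, hn⟩ := mem_groupG_iff.1 hg
  obtain ⟨m, hm, -⟩ := hn.exists_sectionAt hd
  exact mem_groupG_iff.2 ⟨_, hm x⟩

/-- If only the section at `x` is non-trivial, it carries twice the exponent sum. -/
theorem HasExp.sectionAt_of_forall_ne (hd : 3 ≤ d) {g : treeAut d} {n : ℤ} (h : HasExp g n)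
    {x : Fin d} (hx : ∀ y, y ≠ x → sectionAt g [y] = 1) : HasExp (sectionAt g [x]) (2 * n) := by
  obtain ⟨m, hm, hsum⟩ := h.exists_sectionAt hd
  rw [Finset.sum_eq_single x (fun y _ hy => (hm y).unique hd (hx y hy ▸ HasExp.one))
    (by simp)] at hsum
  exact hsum ▸ hm x

/-! ### Self-replication and level transitivity -/

/-- Some element of `G_d` maps the letter `x` to `y` with section `g` at `x`. -/
def Reach (x y : Fin d) (g : treeAut d) : Prop :=
  ∃ h ∈ groupG d, rootPerm h x = y ∧ sectionAt h [x] = g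

theorem Reach.refl (x : Fin d) : Reach x x 1 := ⟨1, one_mem _, by simp, sectionAt_one _⟩

theorem Reach.trans {x y z : Fin d} {g h : treeAut d} (hg : Reach x y g) (hh : Reach y z h) :
    Reach x z (h * g) := by
  obtain ⟨s, hs, rfl, rfl⟩ := hg
  obtain ⟨t, ht, rfl, rfl⟩ := hh
  exact ⟨t * s, mul_mem ht hs, by simp, sectionAt_mul_singleton t s x⟩

theorem Reach.symm {x y : Fin d} {g : treeAut d} (hg : Reach x y g) : Reach y x g⁻¹ := by
  obtain ⟨s, hs, rfl, rfl⟩ := hg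
  refine ⟨s⁻¹, inv_mem hs, ?_, ?_⟩
  · rw [map_inv]
    exact (rootPerm s).symm_apply_apply x
  · rw [sectionAt_inv_singleton]
    congr 3
    exact (rootPerm s).symm_apply_apply x

theorem reach_gen (x : Fin d) : Reach x (finRotate d x) (gen x) :=
  ⟨gen x, gen_mem_groupG x, by rw [rootPerm_gen, Equiv.swap_apply_left],
    by rw [sectionAt_gen, if_pos rfl]⟩

theorem reach_gen' (hd : 2 ≤ d) (x : Fin d) :
    Reach (finRotate d x) x (gen (finRotate d x)) :=
  ⟨gen x, gen_mem_groupG x, by rw [rootPerm_gen, Equiv.swap_apply_right],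
    by rw [sectionAt_gen, if_neg (finRotate_ne hd x), if_pos rfl]⟩

theorem finRotate_pow_self (hd : 2 ≤ d) : finRotate d ^ d = 1 := by
  obtain ⟨n, rfl⟩ := Nat.exists_eq_add_of_le' hd
  have h := isCycle_finRotate (n := n) |>.orderOf
  rw [support_finRotate, Finset.card_univ, Fintype.card_fin] at h
  have h2 := pow_orderOf_eq_one (finRotate (n + 2))
  rwa [h] at h2

/-- A property of pairs of letters that is reflexive, transitive and holds between `x` and its
second successor holds for all pairs, as `d` is odd. -/
theorem forall_of_finRotate_finRotate (hd : 3 ≤ d) (hodd : Odd d) {p : Fin d → Fin d → Prop}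
    (hrefl : ∀ x, p x x) (htrans : ∀ x y z, p x y → p y z → p x z)
    (h2 : ∀ x, p x (finRotate d (finRotate d x))) (x y : Fin d) : p x y := by
  have h1 : ∀ n : ℕ, ∀ x, p x ((finRotate d ^ (2 * n)) x) := by
    intro n
    induction n with
    | zero => simpa using hrefl
    | succ n ih =>
      intro x
      refine htrans _ _ _ (ih x) ?_
      rw [mul_add, mul_one, add_comm, pow_add, Equiv.Perm.mul_apply, pow_two]
      exact h2 _
  have h3 : ∀ n : ℕ, ∀ x, p x ((finRotate d ^ n) x) := by
    intro n x
    rcases Nat.even_or_odd' n with ⟨m, rfl | rfl⟩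
    · exact h1 m x
    · obtain ⟨e, he⟩ := hodd
      -- An odd number of rotations becomes even after adding the full turn `d = 2e + 1`.
      have h4 := h1 (m + e + 1) x
      rwa [show 2 * (m + e + 1) = 2 * m + 1 + d by omega, pow_add, finRotate_pow_self (by omega),
        mul_one] at h4
  obtain ⟨n, rfl⟩ := Nat.exists_eq_add_of_le' hd
  obtain ⟨m, hm⟩ := (isCycle_finRotate (n := n + 1)).exists_pow_eq (finRotate_ne (by omega) x)
    (finRotate_ne (by omega) y)
  exact hm ▸ h3 m x

/-- Going from `x` to its successor by `a_x⁻¹` and on by the next generator gives two sections that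
cancel; oddness of `d` turns these double steps into all pairs. -/
theorem reach_one (hd : 3 ≤ d) (hodd : Odd d) (x y : Fin d) : Reach x y 1 := by
  refine forall_of_finRotate_finRotate hd hodd (p := fun x y => Reach x y 1) Reach.refl
    (fun x y z h h' => by simpa using h.trans h') (fun x => ?_) x y
  simpa using (reach_gen' (by omega) x).symm.trans (reach_gen (finRotate d x))

/-- Self-replication: a generator is picked up as a section by travelling to its own index and away
again with trivial sections. -/
theorem reach_of_mem (hd : 3 ≤ d) (hodd : Odd d) {g : treeAut d} (hg : g ∈ groupG d)
    (x y : Fin d) : Reach x y g := by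
  have h1 := reach_one hd hodd
  induction hg using Subgroup.closure_induction generalizing x y with
  | mem g hg =>
    obtain ⟨i, rfl⟩ := hg
    simpa using ((h1 x i).trans (reach_gen i)).trans (h1 _ y)
  | one => exact h1 x y
  | mul g h _ _ ihg ihh => exact (ihh x x).trans (ihg x y)
  | inv g _ ih => exact (ih y x).symm

theorem isLevelTransitive_groupG (hd : 3 ≤ d) (hodd : Odd d) : IsLevelTransitive (groupG d) := by
  intro u
  induction u with
  | nil =>
    intro v hv
    obtain rfl := List.length_eq_zero_iff.1 hv.symm
    exact ⟨1, one_mem _, rfl⟩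
  | cons x u ih =>
    rintro (_ | ⟨y, v⟩) hv
    · simp at hv
    · obtain ⟨g, hg, rfl⟩ := ih v (by simpa using hv)
      obtain ⟨h, hh, rfl, rfl⟩ := reach_of_mem hd hodd hg x y
      exact ⟨h, hh, apply_cons h x u⟩

/-! ### There is no subgroup over which the group is regular branch -/

theorem not_isRegularBranchOver (hd : 3 ≤ d) (K : Subgroup (treeAut d)) :
    ¬ IsRegularBranchOver (groupG d) K := by
  intro hK
  have x : Fin d := ⟨0, by omega⟩
  let p : ℕ → Prop := fun n => 0 < n ∧ ∃ g ∈ K, HasExp g n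
  have hp : ∃ n, p n := by
    -- Finite index puts a positive power of a generator into `K`.
    obtain ⟨n, hn, -, h⟩ := Subgroup.exists_pow_mem_of_index_ne_zero hK.finiteIndex.index_ne_zero
      (⟨gen x, gen_mem_groupG x⟩ : groupG d)
    exact ⟨n, hn, gen x ^ n, Subgroup.mem_subgroupOf.1 h, by simpa using (HasExp.gen x).pow n⟩
  obtain ⟨m, ⟨hm, k, hk, hkm⟩, hmin⟩ : ∃ m, p m ∧ ∀ n, p n → m ≤ n := by
    classical exact ⟨Nat.find hp, Nat.find_spec hp, fun n hn => Nat.find_min' hp hn⟩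
  -- The element with `k` at one letter and trivial sections elsewhere has half the exponent sum of
  -- `k`, against minimality.
  obtain ⟨g, hg, hsec⟩ := hK.prod_le (fun y => if y = x then k else 1) (fun y => by
    split_ifs
    exacts [hk, one_mem K])
  obtain ⟨n, hn⟩ := mem_groupG_iff.1 (hK.le hg.1)
  have h1 := hn.sectionAt_of_forall_ne hd (x := x) (fun y hy => by rw [hsec, if_neg hy])
  rw [hsec, if_pos rfl] at h1
  have h2 := h1.unique hd hkm
  have h3 := hmin n.toNat ⟨by omega, g, hg.1, by rwa [Int.toNat_of_nonneg (by omega)]⟩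
  omega

/-! ### Rigid stabilizers -/

theorem mem_rigidStabilizer_cons {G : Subgroup (treeAut d)} {g : treeAut d} {x : Fin d}
    {u : List (Fin d)} : g ∈ rigidStabilizer G (x :: u) ↔ g ∈ G ∧ rootPerm g = 1 ∧
      (∀ y, y ≠ x → sectionAt g [y] = 1) ∧ ∀ w, ¬ u <+: w → sectionAt g [x] w = w := by
  constructor
  · rintro ⟨hG, h⟩
    have h1 : ∀ y, y ≠ x → ∀ w, rootPerm g y = y ∧ sectionAt g [y] w = w := by
      intro y hy w
      have h2 := h (y :: w) (fun h3 => hy (List.cons_prefix_cons.1 h3).1.symm)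
      rw [apply_cons] at h2
      exact List.cons_eq_cons.1 h2
    have h4 : rootPerm g = 1 := by
      ext1 y
      by_cases hy : y = x
      · subst hy
        by_contra hne
        exact hne ((rootPerm g).injective (h1 _ hne []).1)
      · exact (h1 y hy []).1
    refine ⟨hG, h4, fun y hy => ext' fun w => (h1 y hy w).2, fun w hw => ?_⟩
    have h2 := h (x :: w) (fun h3 => hw (List.cons_prefix_cons.1 h3).2)
    rw [apply_cons] at h2
    exact (List.cons_eq_cons.1 h2).2
  · rintro ⟨hG, h1, h2, h3⟩
    refine ⟨hG, ?_⟩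
    rintro (_ | ⟨y, w⟩) hw
    · exact apply_nil g
    · rw [apply_cons, h1]
      by_cases hy : y = x
      · subst hy
        rw [h3 w fun h => hw (List.cons_prefix_cons.2 ⟨rfl, h⟩)]
        rfl
      · rw [h2 y hy]
        rfl

/-- `g` is the section at `x` of an element of the rigid stabilizer of the letter `x`. -/
def IsRigidSection (x : Fin d) (g : treeAut d) : Prop :=
  ∃ h ∈ groupG d, rootPerm h = 1 ∧ sectionAt h [x] = g ∧ ∀ y, y ≠ x → sectionAt h [y] = 1

theorem sectionAt_mul_of_rootPerm {g h : treeAut d} (hh : rootPerm h = 1) (x : Fin d) :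
    sectionAt (g * h) [x] = sectionAt g [x] * sectionAt h [x] := by
  rw [sectionAt_mul_singleton, hh]
  rfl

theorem sectionAt_inv_apply (g : treeAut d) (x : Fin d) :
    sectionAt g⁻¹ [rootPerm g x] = (sectionAt g [x])⁻¹ := by
  rw [sectionAt_inv_singleton]
  congr 3
  exact (rootPerm g).symm_apply_apply x

theorem sectionAt_conj {g h : treeAut d} (hh : rootPerm h = 1) (x : Fin d) :
    sectionAt (g * h * g⁻¹) [rootPerm g x] =
      sectionAt g [x] * sectionAt h [x] * (sectionAt g [x])⁻¹ := by
  have h1 : rootPerm g⁻¹ (rootPerm g x) = x := by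
    rw [map_inv]
    exact (rootPerm g).symm_apply_apply x
  rw [sectionAt_mul_singleton, sectionAt_inv_apply, h1, sectionAt_mul_of_rootPerm hh]

theorem rootPerm_conj {g h : treeAut d} (hh : rootPerm h = 1) :
    rootPerm (g * h * g⁻¹) = 1 := by
  simp [hh]

/-- Conjugate the lift of `g` by an element taking `x` to `y` with section `t`, which
self-replication provides. -/
theorem IsRigidSection.conj (hd : 3 ≤ d) (hodd : Odd d) {x : Fin d} {g t : treeAut d}
    (hg : IsRigidSection x g) (ht : t ∈ groupG d) (y : Fin d) :
    IsRigidSection y (t * g * t⁻¹) := by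
  obtain ⟨h, hG, h1, rfl, h2⟩ := hg
  obtain ⟨s, hs, rfl, rfl⟩ := reach_of_mem hd hodd ht x y
  refine ⟨s * h * s⁻¹, mul_mem (mul_mem hs hG) (inv_mem hs), rootPerm_conj h1,
    sectionAt_conj h1 x, fun z hz => ?_⟩
  obtain ⟨z, rfl⟩ := (rootPerm s).surjective z
  rw [sectionAt_conj h1, h2 z (fun h => hz (h ▸ rfl)), mul_one, mul_inv_cancel]

/-- The sections at the letters of elements of their rigid stabilizers. -/
def rigidSections (d : ℕ) : Subgroup (treeAut d) where
  carrier := {g | ∀ x, IsRigidSection x g}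
  mul_mem' {g g'} hg hg' x := by
    obtain ⟨h, hG, h1, rfl, h2⟩ := hg x
    obtain ⟨h', hG', h1', rfl, h2'⟩ := hg' x
    refine ⟨h * h', mul_mem hG hG', by rw [map_mul, h1, h1', mul_one],
      sectionAt_mul_of_rootPerm h1' x, fun y hy => ?_⟩
    rw [sectionAt_mul_of_rootPerm h1', h2 y hy, h2' y hy, mul_one]
  one_mem' _ := ⟨1, one_mem _, map_one _, sectionAt_one _, fun _ _ => sectionAt_one _⟩
  inv_mem' {g} hg x := by
    obtain ⟨h, hG, h1, rfl, h2⟩ := hg x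
    have h3 : ∀ y, sectionAt h⁻¹ [y] = (sectionAt h [y])⁻¹ := fun y => by
      rw [sectionAt_inv_singleton, h1]
      rfl
    refine ⟨h⁻¹, inv_mem hG, by rw [map_inv, h1, inv_one], h3 x, fun y hy => ?_⟩
    rw [h3, h2 y hy, inv_one]

theorem IsRigidSection.mem (hd : 3 ≤ d) (hodd : Odd d) {x : Fin d} {g : treeAut d}
    (hg : IsRigidSection x g) : g ∈ rigidSections d := fun y => by
  simpa using hg.conj hd hodd (one_mem _) y

theorem conj_mem_rigidSections (hd : 3 ≤ d) (hodd : Odd d) {g t : treeAut d}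
    (hg : g ∈ rigidSections d) (ht : t ∈ groupG d) : t * g * t⁻¹ ∈ rigidSections d :=
  fun y => (hg y).conj hd hodd ht y

/-- Two elements that agree on the first level except below `x` differ by an element supported
there; this is how rigid sections are produced below. -/
theorem isRigidSection_of_forall_ne {g h : treeAut d} (hg : g ∈ groupG d) (hh : h ∈ groupG d)
    (h1 : rootPerm g = rootPerm h) {x : Fin d}
    (h2 : ∀ y, y ≠ x → sectionAt g [y] = sectionAt h [y]) :
    IsRigidSection x ((sectionAt g [x])⁻¹ * sectionAt h [x]) := by
  have h3 : ∀ y, sectionAt (g⁻¹ * h) [y] = (sectionAt g [y])⁻¹ * sectionAt h [y] := by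
    intro y
    rw [sectionAt_mul_singleton, ← h1, sectionAt_inv_apply]
  refine ⟨g⁻¹ * h, mul_mem (inv_mem hg) hh, by simp [h1], h3 x, fun y hy => ?_⟩
  rw [h3, h2 y hy, inv_mul_cancel]

/-! ### Elements of exponent sum zero -/

/-- With `j = i + 1` and `k = i + 2`, the two sides of the braid relation, `a_j a_i a_j` and `a_i
a_j a_i`, differ only below `j`, where their sections are `a_k a_j` and `a_i a_j`. -/
theorem gen_mul_inv_gen_mem_of_braid (hd : 3 ≤ d) (hodd : Odd d) (i : Fin d) :
    gen i * (gen (finRotate d (finRotate d i)))⁻¹ ∈ rigidSections d := by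
  have hij := finRotate_ne (by omega) i
  have hjk := finRotate_ne (by omega) (finRotate d i)
  have hik := finRotate_finRotate_ne hd i
  have hi := rootPerm_gen i
  have hj := rootPerm_gen (finRotate d i)
  have hsi := sectionAt_gen i
  have hsj := sectionAt_gen (finRotate d i)
  have hGi := gen_mem_groupG i
  have hGj := gen_mem_groupG (finRotate d i)
  have hGk := gen_mem_groupG (finRotate d (finRotate d i))
  generalize finRotate d (finRotate d i) = k at *
  generalize finRotate d i = j at *
  have h := isRigidSection_of_forall_ne (x := j) (mul_mem (mul_mem hGj hGi) hGj)
    (mul_mem (mul_mem hGi hGj) hGi) ?_ ?_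
  · have h1 := h.mem hd hodd
    have h2 : sectionAt (gen j * gen i * gen j) [j] = gen k * gen j := by
      simp [sectionAt_mul_singleton, hi, hj, hsi, hsj, hjk, hik,
        Equiv.swap_apply_of_ne_of_ne hik hjk]
    have h3 : sectionAt (gen i * gen j * gen i) [j] = gen i * gen j := by
      simp [sectionAt_mul_singleton, hi, hj, hsi, hsj, hij, hij.symm, hik.symm,
        Equiv.swap_apply_of_ne_of_ne hij.symm hik.symm]
    rw [h2, h3] at h1
    have h4 := conj_mem_rigidSections hd hodd h1 (mul_mem hGk hGj)
    convert h4 using 1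
    group
  · rw [map_mul, map_mul, map_mul, map_mul, hi, hj]
    ext1 y
    simp only [Equiv.Perm.mul_apply, Equiv.swap_apply_def]
    grind
  · intro y hy
    simp only [sectionAt_mul_singleton, hi, hj, hsi, hsj,
      Equiv.swap_apply_def]
    by_cases hyi : y = i
    · subst hyi
      simp [*, hij.symm, hik.symm]
    · by_cases hyk : y = k
      · subst hyk
        simp [*, hij.symm, hik.symm]
      · simp [*]

theorem gen_mul_inv_gen_mem (hd : 3 ≤ d) (hodd : Odd d) (i j : Fin d) :
    gen i * (gen j)⁻¹ ∈ rigidSections d := by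
  refine forall_of_finRotate_finRotate hd hodd
    (p := fun i j => gen i * (gen j)⁻¹ ∈ rigidSections d) (fun x => ?_)
    (fun x y z h h' => ?_) (gen_mul_inv_gen_mem_of_braid hd hodd) i j
  · simp [one_mem]
  · simpa [mul_assoc] using mul_mem h h'

/-- Modulo `rigidSections`, which `G_d` normalizes, all generators coincide, so only the exponent
sum survives. -/
theorem mul_inv_gen_zpow_mem (hd : 3 ≤ d) (hodd : Odd d) (i : Fin d) {g : treeAut d} {n : ℤ}
    (hg : HasExp g n) : g * (gen i ^ n)⁻¹ ∈ rigidSections d := by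
  obtain ⟨L, rfl, rfl⟩ := hasExp_iff_listAut.1 hg
  clear hg
  induction L with
  | nil => simp [listAut, listExp, one_mem]
  | cons l L ih =>
    have h1 : letterAut l ∈ groupG d ∧ letterAut l * (gen i ^ letterExp l)⁻¹ ∈ rigidSections d := by
      rcases l with ⟨j, b⟩
      have hj := gen_mem_groupG j
      cases b
      · refine ⟨inv_mem hj, ?_⟩
        have h2 := conj_mem_rigidSections hd hodd (gen_mul_inv_gen_mem hd hodd i j) (inv_mem hj)
        simpa [letterAut, letterExp, mul_assoc] using h2
      · exact ⟨hj, by simpa [letterAut, letterExp] using gen_mul_inv_gen_mem hd hodd j i⟩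
    have h3 := mul_mem (conj_mem_rigidSections hd hodd ih h1.1) h1.2
    rw [listAut_cons, listExp_cons, add_comm, zpow_add]
    convert h3 using 1
    group

theorem HasExp.mem_rigidSections_of_zero (hd : 3 ≤ d) (hodd : Odd d) {g : treeAut d}
    (hg : HasExp g 0) : g ∈ rigidSections d := by
  simpa using mul_inv_gen_zpow_mem hd hodd ⟨0, by omega⟩ hg

theorem exists_sectionAt_eq (f : Fin d → treeAut d) (hf : ∀ x, f x ∈ rigidSections d) :
    ∃ g ∈ groupG d, rootPerm g = 1 ∧ ∀ x, sectionAt g [x] = f x := by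
  have h : ∀ s : Finset (Fin d), ∃ g ∈ groupG d, rootPerm g = 1 ∧
      ∀ x, sectionAt g [x] = if x ∈ s then f x else 1 := by
    intro s
    induction s using Finset.induction_on with
    | empty => exact ⟨1, one_mem _, map_one _, fun x => by simp [sectionAt_one]⟩
    | insert a s ha ih =>
      obtain ⟨g, hG, h1, h2⟩ := ih
      obtain ⟨h, hG', h1', h2', h3⟩ := hf a a
      refine ⟨g * h, mul_mem hG hG', by rw [map_mul, h1, h1', mul_one], fun x => ?_⟩
      rw [sectionAt_mul_of_rootPerm h1', h2]
      by_cases hx : x = a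
      · subst hx
        simp [ha, h2']
      · simp [hx, h3 x hx]
  simpa using h Finset.univ

/-- The sections of sum zero are rigid sections, so they can be divided out one letter at a time
without touching the section at `x`. -/
theorem isRigidSection_of_hasExp_zero (hd : 3 ≤ d) (hodd : Odd d) {g : treeAut d}
    (hg : g ∈ groupG d) (h1 : rootPerm g = 1) {x : Fin d}
    (h2 : ∀ y, y ≠ x → HasExp (sectionAt g [y]) 0) : IsRigidSection x (sectionAt g [x]) := by
  obtain ⟨h, hG, h3, h4⟩ := exists_sectionAt_eq (fun y => if y = x then 1 else sectionAt g [y])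
    (fun y => by
      split_ifs with hy
      exacts [one_mem _, (h2 y hy).mem_rigidSections_of_zero hd hodd])
  have h5 := isRigidSection_of_forall_ne (x := x) hG hg (h3.trans h1.symm)
    (fun y hy => by rw [h4, if_neg hy])
  simpa [h4] using h5

/-! ### Elements of exponent sum divisible by four -/

theorem hasExp_sectionAt_gen_mul_gen (hd : 3 ≤ d) (i x : Fin d) :
    HasExp (sectionAt (gen i * gen i) [x]) (if x = i ∨ x = finRotate d i then 2 else 0) := by
  have hij := finRotate_ne (by omega) i
  rw [sectionAt_mul_singleton, rootPerm_gen]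
  by_cases hi : x = i
  · subst hi
    rw [Equiv.swap_apply_left, sectionAt_gen, sectionAt_gen, if_neg hij, if_pos rfl, if_pos rfl,
      if_pos (Or.inl rfl)]
    exact (HasExp.gen _).mul (HasExp.gen _)
  · by_cases hj : x = finRotate d i
    · subst hj
      rw [Equiv.swap_apply_right, sectionAt_gen, sectionAt_gen, if_neg hij, if_pos rfl, if_pos rfl,
        if_pos (Or.inr rfl)]
      exact (HasExp.gen _).mul (HasExp.gen _)
    · rw [Equiv.swap_apply_of_ne_of_ne hi hj, sectionAt_gen, if_neg hi, if_neg hj,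
        if_neg (not_or.2 ⟨hi, hj⟩)]
      exact HasExp.one.mul HasExp.one

/-- With `j = i + 1` and `k = i + 2`, the squares `a_i²`, `a_j a_i² a_j⁻¹` and `a_j²` have sections
of sum two at `{i, j}`, `{i, k}` and `{j, k}`. The first two times the inverse of the third leaves
four at `i` and zero elsewhere. -/
theorem exists_mem_rigidSections_hasExp_four (hd : 3 ≤ d) (hodd : Odd d) :
    ∃ g ∈ rigidSections d, HasExp g 4 := by
  let i : Fin d := ⟨0, by omega⟩
  have hij := finRotate_ne (by omega) i
  have hjk := finRotate_ne (by omega) (finRotate d i)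
  have hik := finRotate_finRotate_ne hd i
  have hsq : ∀ l : Fin d, rootPerm (gen l * gen l) = 1 := fun l => by
    rw [map_mul, rootPerm_gen, Equiv.swap_mul_self]
  have hci := hasExp_sectionAt_gen_mul_gen hd i
  have hcj := hasExp_sectionAt_gen_mul_gen hd (finRotate d i)
  have hj := rootPerm_gen (finRotate d i)
  have hGi := gen_mem_groupG i
  have hGj := gen_mem_groupG (finRotate d i)
  generalize finRotate d (finRotate d i) = k at *
  generalize finRotate d i = j at *
  have hconj : ∀ x, HasExp (sectionAt (gen j * (gen i * gen i) * (gen j)⁻¹) [x])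
      (if Equiv.swap j k x = i ∨ Equiv.swap j k x = j then 2 else 0) := by
    intro x
    obtain ⟨x, rfl⟩ := (Equiv.swap j k).surjective x
    obtain ⟨m, hm⟩ := mem_groupG_iff.1 (sectionAt_mem_groupG hd hGj x)
    rw [Equiv.swap_apply_self]
    have h := (hm.mul (hci x)).mul hm.inv
    rw [← sectionAt_conj (hsq i), hj] at h
    simpa using h
  have hP := rootPerm_conj (g := gen j) (hsq i)
  have hinv : ∀ x, sectionAt (gen j * gen j)⁻¹ [x] = (sectionAt (gen j * gen j) [x])⁻¹ := by
    intro x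
    have h := sectionAt_inv_apply (gen j * gen j) x
    rwa [hsq] at h
  have hall : ∀ x, HasExp (sectionAt ((gen i * gen i) * (gen j * (gen i * gen i) * (gen j)⁻¹) *
      (gen j * gen j)⁻¹) [x]) (if x = i then 4 else 0) := by
    intro x
    have h := ((hci x).mul (hconj x)).mul (hcj x).inv
    rw [sectionAt_mul_of_rootPerm (by rw [map_inv, hsq, inv_one]), sectionAt_mul_of_rootPerm hP,
      hinv]
    convert h using 1
    simp only [Equiv.swap_apply_def]
    by_cases hxi : x = i
    · rw [hxi]
      simp [hij.symm, hik.symm]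
    · by_cases hxj : x = j
      · rw [hxj]
        simp [hij, hik, hjk]
      · by_cases hxk : x = k
        · rw [hxk]
          simp [hik, hjk]
        · simp [hxi, hxj, hxk]
  refine ⟨_, (isRigidSection_of_hasExp_zero hd hodd (x := i) (mul_mem (mul_mem (mul_mem hGi hGi)
    (mul_mem (mul_mem hGj (mul_mem hGi hGi)) (inv_mem hGj))) (inv_mem (mul_mem hGj hGj))) ?_
    fun y hy => ?_).mem hd hodd, ?_⟩
  · rw [map_mul, map_mul, hP, hsq, map_inv, hsq, mul_one, inv_one, mul_one]
  · simpa [hy] using hall y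
  · simpa using hall i

theorem HasExp.mem_rigidSections (hd : 3 ≤ d) (hodd : Odd d) {g : treeAut d} {n : ℤ}
    (hg : HasExp g n) (hn : 4 ∣ n) : g ∈ rigidSections d := by
  obtain ⟨m, rfl⟩ := hn
  obtain ⟨t, ht, ht4⟩ := exists_mem_rigidSections_hasExp_four hd hodd
  have h1 := hg.mul (ht4.zpow m).inv
  rw [mul_comm 4 m, add_neg_cancel] at h1
  simpa using mul_mem (h1.mem_rigidSections_of_zero hd hodd) (zpow_mem ht m)

/-! ### Rigid stabilizers of deeper vertices -/

theorem sectionAt_nil (g : treeAut d) : sectionAt g [] = g := ext' fun w => by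
  have h := sectionAt_spec g [] w
  rw [apply_nil] at h
  exact h.symm

theorem HasExp.sectionAt_of_mem_rigidStabilizer (hd : 3 ≤ d) {v : List (Fin d)} {g : treeAut d}
    {n : ℤ} (hg : HasExp g n) (h : g ∈ rigidStabilizer (groupG d) v) :
    HasExp (sectionAt g v) (2 ^ v.length * n) := by
  induction v generalizing g n with
  | nil =>
    simpa [sectionAt_nil] using hg
  | cons x u ih =>
    obtain ⟨hG, -, h2, h3⟩ := mem_rigidStabilizer_cons.1 h
    have h4 := ih (hg.sectionAt_of_forall_ne hd h2) ⟨sectionAt_mem_groupG hd hG x, h3⟩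
    rw [← sectionAt_append, ← mul_assoc, ← pow_succ] at h4
    exact h4

theorem sectionAt_mem_groupH (hd : 3 ≤ d) {x : Fin d} {u : List (Fin d)} {g : treeAut d}
    (h : g ∈ rigidStabilizer (groupG d) (x :: u)) :
    sectionAt g (x :: u) ∈ groupH d (u.length + 1) := by
  obtain ⟨hG, h1, -, -⟩ := mem_rigidStabilizer_cons.1 h
  obtain ⟨n, hn⟩ := mem_groupG_iff.1 hG
  -- Trivial action on the first level gives the factor two beyond the `2 ^ k` of the doubling.
  obtain ⟨m, rfl⟩ := (hn.even hd h1).two_dvd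
  refine mem_groupH_iff.2 ⟨_, hn.sectionAt_of_mem_rigidStabilizer hd h, m, ?_⟩
  rw [List.length_cons]
  ring

theorem exists_mem_rigidStabilizer (hd : 3 ≤ d) (hodd : Odd d) (x : Fin d) (u : List (Fin d))
    {g : treeAut d} (hg : g ∈ groupH d (u.length + 1)) :
    ∃ h ∈ rigidStabilizer (groupG d) (x :: u), sectionAt h (x :: u) = g := by
  induction u generalizing x with
  | nil =>
    obtain ⟨n, hn, hdvd⟩ := mem_groupH_iff.1 hg
    obtain ⟨h, hG, h1, rfl, h2⟩ := hn.mem_rigidSections hd hodd hdvd x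
    exact ⟨h, mem_rigidStabilizer_cons.2 ⟨hG, h1, h2, fun w hw => absurd w.nil_prefix hw⟩, rfl⟩
  | cons y u ih =>
    obtain ⟨n, hn, hdvd⟩ := mem_groupH_iff.1 hg
    obtain ⟨s, hs, rfl⟩ := ih y
      (mem_groupH_iff.2 ⟨n, hn, (pow_dvd_pow 2 (Nat.le_succ _)).trans hdvd⟩)
    obtain ⟨m, hm⟩ := mem_groupG_iff.1 hs.1
    -- The sum of `g` is `2 ^ (u.length + 1) * m`, so divisibility by `2 ^ (u.length + 3)` leaves `4
    -- ∣ m`, just what lifting `s` one level to `x` requires.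
    rw [← (hm.sectionAt_of_mem_rigidStabilizer hd hs).unique hd hn, add_assoc, pow_add] at hdvd
    obtain ⟨h, hG, h1, rfl, h2⟩ := hm.mem_rigidSections hd hodd
      ((mul_dvd_mul_iff_left (by positivity)).1 hdvd) x
    exact ⟨h, mem_rigidStabilizer_cons.2 ⟨hG, h1, h2, hs.2⟩, sectionAt_append h [x] (y :: u)⟩

theorem groupH_injective (hd : 3 ≤ d) : Function.Injective (groupH d) := by
  have key : ∀ j k, groupH d j = groupH d k → k ≤ j := by
    intro j k h
    let i : Fin d := ⟨0, by omega⟩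
    -- This power has the least positive sum allowed in `H_j`; its membership in `H_k` forces `k ≤
    -- j`.
    have h1 : HasExp (gen i ^ 2 ^ (j + 1)) (2 ^ (j + 1)) := by
      simpa using (HasExp.gen i).pow (2 ^ (j + 1))
    obtain ⟨n, hn, hdvd⟩ := mem_groupH_iff.1 (h ▸ mem_groupH_iff.2 ⟨_, h1, dvd_rfl⟩)
    rw [← h1.unique hd hn] at hdvd
    have h2 : (2 : ℕ) ^ (k + 1) ∣ 2 ^ (j + 1) := by exact_mod_cast hdvd
    have h3 := (Nat.pow_dvd_pow_iff_le_right (le_refl 2)).1 h2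
    omega
  exact fun j k h => le_antisymm (key k j h.symm) (key j k h)

end RootedTree

theorem mainTheorem8 (d : ℕ) (hd : 3 ≤ d) (hodd : Odd d) :
    RootedTree.IsLevelTransitive (RootedTree.groupG d) ∧
    (∀ K : Subgroup (RootedTree.treeAut d),
      ¬ RootedTree.IsRegularBranchOver (RootedTree.groupG d) K) ∧
    (∀ w w' : FreeGroup (Fin d), RootedTree.evalWord w = RootedTree.evalWord w' →
      RootedTree.expSum w = RootedTree.expSum w') ∧
    (∀ k : ℕ, 1 ≤ k → ∀ v : List (Fin d), v.length = k →
      (fun g => RootedTree.sectionAt g v) ''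
          (RootedTree.rigidStabilizer (RootedTree.groupG d) v : Set (RootedTree.treeAut d)) =
        (RootedTree.groupH d k : Set (RootedTree.treeAut d))) ∧
    (∀ j k : ℕ, 1 ≤ j → 1 ≤ k → RootedTree.groupH d j = RootedTree.groupH d k → j = k) := by
  refine ⟨RootedTree.isLevelTransitive_groupG hd hodd, RootedTree.not_isRegularBranchOver hd,
    fun w w' => RootedTree.expSum_eq_of_evalWord_eq hd, ?_,
    fun j k _ _ h => RootedTree.groupH_injective hd h⟩
  rintro k hk (_ | ⟨x, u⟩) rfl
  · simp at hk
  · apply Set.Subset.antisymm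
    · rintro _ ⟨g, hg, rfl⟩
      exact RootedTree.sectionAt_mem_groupH hd hg
    · exact fun g hg => RootedTree.exists_mem_rigidStabilizer hd hodd x u hg
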